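/- Call a topological space $X$ \emph{nowhere dense homogeneous} (NDH) if $X$ has a nonempty closed nowhere dense subset and, for any two closed nowhere dense subsets $F, G \subseteq X$ and any homeomorphism $f \colon F \to G$ (with the subspace topologies), there is a homeomorphism $\bar f \colon X \to X$ of $X$ onto itself with $\bar f(x) = f(x)$ for all $x \in F$. Let $\mathbb C \subset [0,1]$ be the Cantor ternary set, $\mathbb Q$ the space of rational numbers and $\mathbb P = \mathbb R \setminus \mathbb Q$ the space of irrational numbers, each with the topology inherited from $\mathbb R$. Then the spaces $\mathbb C$, $\mathbb Q$, $\mathbb P$, $\mathbb C \times \mathbb Q$ and $\mathbb P \times \mathbb Q$ (with the product topologies) are all NDH. -/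

import Mathlib

/-- A topological space is nowhere dense homogeneous if it has a nonempty closed nowhere dense
subset and every homeomorphism between two closed nowhere dense subsets extends to a
homeomorphism of the whole space onto itself. -/
def NowhereDenseHomogeneous (X : Type*) [TopologicalSpace X] : Prop :=
  (∃ F : Set X, F.Nonempty ∧ IsClosed F ∧ IsNowhereDense F) ∧
    ∀ F G : Set X, IsClosed F → IsNowhereDense F → IsClosed G → IsNowhereDense G →
      ∀ f : F ≃ₜ G, ∃ h : X ≃ₜ X, ∀ x : F, h (x : X) = (f x : X)

/-! ### Gluing homeomorphisms along clopen partitions -/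

open Set Filter Topology Metric

/-! The argument is of Knaster–Reichbach type. Two properties of a space `X` give the extension of
homeomorphisms: it embeds in the Cantor space, hence carries an ultrametric, and all its nonempty
clopen subsets are homeomorphic to it.

Regard `F` and `G` as two closed nowhere dense embeddings of one space `A = F`. In an ultrametric
space each image is a retract, and its complement splits into clopen shells that shrink to the
image. Cut the `j`-th shell by pulling back, along the retraction, the `j`-th of a sequence of ever
finer finite clopen partitions of `A`. Nowhere density allows the shells to be chosen so that every
piece is nonempty (`IsNhdsTagging.exists_isShelling`). The nonempty pieces of the two complements
then have the same labels, and each is a copy of `X`. Matching pieces by label gives a homeomorphism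
of the complements, and since pieces near the image are small and keep their label, it glues
continuously with `f` (`IsShelling.continuous_shellGlue`).

It remains to identify the clopen subsets. All five spaces have a basis of clopen copies of
themselves. The Cantor set is handled by compactness. Each of the other four is homeomorphic to its
product with `ℕ`, and absorption of summands then identifies every nonempty clopen subset with the
space (`LocallySelfSimilar.nonempty_homeomorph_of_isClopen`). -/

theorem IsLocallyConstant.continuous_of_fibers {X Y ι : Type*} [TopologicalSpace X]
    [TopologicalSpace Y] {p : X → ι} {q : Y → ι} (hp : IsLocallyConstant p)
    (e : ∀ i, (p ⁻¹' {i}) ≃ₜ (q ⁻¹' {i})) : Continuous fun x ↦ (e (p x) ⟨x, rfl⟩ : Y) := by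
  rw [continuous_iff_continuousAt]
  intro x
  have ho : IsOpen (p ⁻¹' {p x}) := hp _
  have hx : (⟨x, rfl⟩ : p ⁻¹' {p x}).1 = x := rfl
  rw [← hx, ← ho.isOpenEmbedding_subtypeVal.continuousAt_iff]
  have : ((fun x ↦ (e (p x) ⟨x, rfl⟩ : Y)) ∘ (Subtype.val : p ⁻¹' {p x} → X)) =
      fun y ↦ (e (p x) y : Y) := by
    have : ∀ i (y : p ⁻¹' {i}), (e (p y) ⟨y, rfl⟩ : Y) = e i y := by
      rintro i ⟨y, rfl⟩; rfl
    exact funext fun y ↦ this _ y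
  rw [this]
  exact (continuous_subtype_val.comp (e (p x)).continuous).continuousAt

/-- Two spaces that are partitioned into pairwise homeomorphic clopen pieces over the same index set
are homeomorphic, by a homeomorphism that respects the partitions. -/
theorem exists_homeomorph_of_fibers {X Y ι : Type*} [TopologicalSpace X] [TopologicalSpace Y]
    {p : X → ι} {q : Y → ι} (hp : IsLocallyConstant p) (hq : IsLocallyConstant q)
    (h : ∀ i, Nonempty ((p ⁻¹' {i}) ≃ₜ (q ⁻¹' {i}))) :
    ∃ g : X ≃ₜ Y, ∀ x, q (g x) = p x := by
  have e := fun i ↦ (h i).some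
  have mem : ∀ x, q (e (p x) ⟨x, rfl⟩) = p x := fun x ↦ (e (p x) ⟨x, rfl⟩).2
  have mem' : ∀ y, p ((e (q y)).symm ⟨y, rfl⟩) = q y := fun y ↦ ((e (q y)).symm ⟨y, rfl⟩).2
  refine ⟨⟨⟨fun x ↦ e (p x) ⟨x, rfl⟩, fun y ↦ (e (q y)).symm ⟨y, rfl⟩, ?_, ?_⟩, ?_, ?_⟩, mem⟩
  · intro x
    -- The index is generalised so that the equality of the labels of a point and its image can be
    -- eliminated by substitution.
    have : ∀ i (hi : i = p x) (hq : q (e (p x) ⟨x, rfl⟩) = i),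
        ((e i).symm ⟨e (p x) ⟨x, rfl⟩, hq⟩ : X) = x := by
      rintro i rfl hq
      exact congrArg Subtype.val ((e (p x)).symm_apply_apply ⟨x, rfl⟩)
    exact this _ (mem x) rfl
  · intro y
    have : ∀ i (hi : i = q y) (hq : p ((e (q y)).symm ⟨y, rfl⟩) = i),
        (e i ⟨(e (q y)).symm ⟨y, rfl⟩, hq⟩ : Y) = y := by
      rintro i rfl hq
      exact congrArg Subtype.val ((e (q y)).apply_symm_apply ⟨y, rfl⟩)
    exact this _ (mem' y) rfl
  · exact hp.continuous_of_fibers e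
  · exact hq.continuous_of_fibers fun i ↦ (e i).symm

/-! ### Separation and retractions in ultrametric spaces -/

section Ultrametric

variable {X : Type*} [MetricSpace X] [IsUltrametricDist X] {F : Set X} {x y : X}

/-- Ultrametric triangles are isosceles. Consequently all distances to points of `F` are locally
constant off a nonempty closed `F`, which drives the separation and retraction arguments. -/
theorem IsUltrametricDist.dist_eq_of_dist_lt_infDist (h : dist x y < infDist x F) {a : X}
    (ha : a ∈ F) : dist y a = dist x a := by
  have h1 : dist x y < dist x a := h.trans_le (infDist_le_dist_of_mem ha)
  apply le_antisymm
  · exact (IsUltrametricDist.dist_triangle_max y x a).trans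
      (max_le (by rw [dist_comm]; exact h1.le) le_rfl)
  · by_contra! h2
    exact absurd (IsUltrametricDist.dist_triangle_max x y a) (not_le.2 (max_lt h1 h2))

theorem IsUltrametricDist.infDist_eq_of_dist_lt_infDist (h : dist x y < infDist x F) :
    infDist y F = infDist x F := by
  rcases F.eq_empty_or_nonempty with rfl | hF
  · simp
  have hF' : Nonempty F := hF.to_subtype
  rw [infDist_eq_iInf, infDist_eq_iInf]
  exact iInf_congr fun a ↦ dist_eq_of_dist_lt_infDist h a.2

theorem eventually_dist_lt_infDist {X : Type*} [MetricSpace X] {F : Set X} {x : X}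
    (hF : IsClosed F) (hne : F.Nonempty) (hx : x ∉ F) :
    ∀ᶠ y in 𝓝 x, dist x y < infDist x F := by
  have : 0 < infDist x F := (hF.notMem_iff_infDist_pos hne).1 hx
  filter_upwards [ball_mem_nhds x this] with y hy
  rwa [dist_comm]

/-- Disjoint closed subsets of an ultrametric space are separated by a clopen set. -/
theorem IsUltrametricDist.exists_isClopen_of_disjoint {D : Set X} (hF : IsClosed F)
    (hD : IsClosed D) (hd : Disjoint F D) : ∃ O : Set X, IsClopen O ∧ F ⊆ O ∧ Disjoint O D := by
  rcases F.eq_empty_or_nonempty with rfl | hne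
  · exact ⟨∅, isClopen_empty, subset_rfl, empty_disjoint _⟩
  rcases D.eq_empty_or_nonempty with rfl | hne'
  · exact ⟨univ, isClopen_univ, subset_univ _, disjoint_empty _⟩
  refine ⟨{x | infDist x F < infDist x D}, ⟨?_, ?_⟩, ?_, ?_⟩
  · rw [← isOpen_compl_iff, isOpen_iff_mem_nhds]
    intro x hx
    simp only [mem_compl_iff, mem_ofPred_eq, not_lt] at hx
    have hxF : x ∉ F := fun h ↦ by
      have h0 := infDist_zero_of_mem h
      have : infDist x D = 0 := le_antisymm (h0 ▸ hx) infDist_nonneg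
      exact Set.disjoint_left.1 hd h ((hD.mem_iff_infDist_zero hne').2 this)
    -- On `D` the inequality is strict and persists by continuity. Off `F ∪ D` both distances are
    -- locally constant, so even a weak inequality persists.
    by_cases hxD : x ∈ D
    · have h1 : infDist x D < infDist x F := by
        rw [infDist_zero_of_mem hxD]
        exact (hF.notMem_iff_infDist_pos hne).1 hxF
      filter_upwards [((continuous_infDist_pt D).continuousAt).eventually_lt
        ((continuous_infDist_pt F).continuousAt) h1] with y hy
      simpa using hy.le
    · filter_upwards [eventually_dist_lt_infDist hF hne hxF,
        eventually_dist_lt_infDist hD hne' hxD] with y h1 h2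
      simpa [infDist_eq_of_dist_lt_infDist h1, infDist_eq_of_dist_lt_infDist h2] using hx
  · exact isOpen_lt (continuous_infDist_pt F) (continuous_infDist_pt D)
  · intro x hx
    simp only [mem_ofPred_eq, infDist_zero_of_mem hx]
    exact (hD.notMem_iff_infDist_pos hne').1 (Set.disjoint_left.1 hd hx)
  · refine Set.disjoint_left.2 fun x hx hxD ↦ ?_
    simp only [mem_ofPred_eq, infDist_zero_of_mem hxD] at hx
    exact absurd hx (not_lt.2 infDist_nonneg)

/-- Nonempty closed subsets of an ultrametric space are retracts. -/
theorem IsUltrametricDist.exists_retraction (hF : IsClosed F) (hne : F.Nonempty) :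
    ∃ r : X → F, Continuous r ∧ ∀ a : F, r a = a := by
  classical
  -- The candidates for the value at `x` are the nearly closest points of `F`. The factor 2 makes
  -- this set nonempty off `F`, where the infimum need not be attained.
  let S : X → Set F := fun x ↦ {a | dist x a < 2 * infDist x F}
  have hS : ∀ x ∉ F, (S x).Nonempty := fun x hx ↦ by
    have h0 : 0 < infDist x F := (hF.notMem_iff_infDist_pos hne).1 hx
    obtain ⟨a, ha, h⟩ := (infDist_lt_iff hne).1 (show infDist x F < 2 * infDist x F by linarith)
    exact ⟨⟨a, ha⟩, h⟩
  obtain ⟨a₀, ha₀⟩ := hne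
  -- The choice depends only on the set of candidates, not on `x`. As that set is locally constant
  -- off `F`, so is the retraction.
  let c : Set F → F := fun s ↦ if h : s.Nonempty then h.some else ⟨a₀, ha₀⟩
  have hc : ∀ s : Set F, s.Nonempty → c s ∈ s := fun s h ↦ by
    simp only [c, dif_pos h]; exact h.some_mem
  let r : X → F := fun x ↦ if h : x ∈ F then ⟨x, h⟩ else c (S x)
  have hr : ∀ a : F, r a = a := fun a ↦ by simp [r]
  have hd : ∀ x, ∀ a ∈ F, dist x (r x : X) ≤ 2 * dist x a := by
    intro x a ha
    by_cases hx : x ∈ F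
    · simp [r, hx]
    · simp only [r, dif_neg hx]
      have : dist x (c (S x) : X) < 2 * infDist x F := hc _ (hS x hx)
      linarith [infDist_le_dist_of_mem (x := x) ha]
  refine ⟨r, ?_, hr⟩
  rw [continuous_iff_continuousAt]
  intro x
  by_cases hx : x ∈ F
  · rw [ContinuousAt, tendsto_subtype_rng, hr ⟨x, hx⟩, tendsto_iff_dist_tendsto_zero]
    -- The 3 is 1 for the distance from `x` to `y` plus 2 for the distance from `y` to its image.
    have h3 : Tendsto (fun y ↦ 3 * dist y x) (𝓝 x) (𝓝 0) := by
      have : Continuous fun y ↦ 3 * dist y x := by fun_prop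
      simpa using this.tendsto x
    refine squeeze_zero (fun _ ↦ dist_nonneg) (fun y ↦ ?_) h3
    have := dist_triangle_left (r y : X) x y
    linarith [hd y x hx]
  · have : r =ᶠ[𝓝 x] fun _ ↦ r x := by
      filter_upwards [eventually_dist_lt_infDist hF ⟨a₀, ha₀⟩ hx,
        hF.isOpen_compl.mem_nhds hx] with y hy hyF
      have : S y = S x := by
        ext a
        simp only [S, mem_ofPred_eq, infDist_eq_of_dist_lt_infDist hy,
          dist_eq_of_dist_lt_infDist hy a.2]
      have hyF : y ∉ F := hyF
      simp only [r, dif_neg hx, dif_neg hyF, this]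
    exact continuousAt_const.congr this.symm

end Ultrametric

/-- A sequence of finite clopen partitions, each refining the previous one, such that the pieces
containing a point form a neighbourhood basis; `T j a` is the label of the piece of `a`. -/
structure IsNhdsTagging {A τ : Type*} [TopologicalSpace A] (T : ℕ → A → τ) : Prop where
  isLocallyConstant : ∀ j, IsLocallyConstant (T j)
  finite_range : ∀ j, (range (T j)).Finite
  mono : ∀ {i j a b}, i ≤ j → T j a = T j b → T i a = T i b
  nhds : ∀ a, ∀ W ∈ 𝓝 a, ∃ j, ∀ b, T j b = T j a → b ∈ W

/-! ### Clopen shells around a closed nowhere dense set -/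

section Shells

variable {X A τ : Type*} [MetricSpace X] [IsUltrametricDist X] [TopologicalSpace A] [Nonempty A]
  {T : ℕ → A → τ} {e : A → X}

/-- As the range has empty interior, a point of `O` off the range can be picked over each of the
finitely many tags. These points form a closed set, so a clopen neighbourhood of the range can avoid
them all, and they remain in `O \ O'`. -/
theorem IsNhdsTagging.exists_smaller_isClopen (hT : IsNhdsTagging T) (he : IsClosedEmbedding e)
    (hnd : interior (range e) = ∅) {r : X → A} (hr : Continuous r) (hre : ∀ a, r (e a) = a)
    (j : ℕ) {O : Set X} (hO : IsClopen O) (heO : range e ⊆ O) :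
    ∃ O' : Set X, (IsClopen O' ∧ range e ⊆ O') ∧ O' ⊆ O ∧
      (∀ x ∈ O', dist x (e (r x)) < (1 / 2) ^ j) ∧ ∀ a, ∃ x ∈ O \ O', T j (r x) = T j a := by
  have hp : ∀ t ∈ range (T j), ∃ x ∈ O, x ∉ range e ∧ T j (r x) = t := by
    rintro _ ⟨a, rfl⟩
    have h1 : O ∩ (fun x ↦ T j (r x)) ⁻¹' {T j a} ∈ 𝓝 (e a) := by
      refine ((hO.isOpen.inter ?_).mem_nhds ⟨heO ⟨a, rfl⟩, by simp [hre]⟩)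
      exact (hT.isLocallyConstant j {T j a}).preimage hr
    by_contra! h
    have : O ∩ (fun x ↦ T j (r x)) ⁻¹' {T j a} ⊆ range e := fun x hx ↦ by
      by_contra hx'
      exact h x hx.1 hx' hx.2
    have := mem_interior_iff_mem_nhds.2 (mem_of_superset h1 this)
    simp [hnd] at this
  have : Nonempty X := .map e ‹_›
  choose! p hpO hpe hpT using hp
  -- The set to avoid: what lies outside `O`, the chosen points, and the points too far from the
  -- image of their retraction.
  have hD : IsClosed (Oᶜ ∪ p '' range (T j) ∪ {x | (1 / 2) ^ j ≤ dist x (e (r x))}) := by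
    refine (hO.compl.isClosed.union ((hT.finite_range j).image p).isClosed).union ?_
    exact isClosed_le continuous_const (continuous_id.dist (he.continuous.comp hr))
  obtain ⟨O', h1, h2, h3⟩ := IsUltrametricDist.exists_isClopen_of_disjoint he.isClosed_range hD (by
    rw [Set.disjoint_left]
    rintro _ ⟨a, rfl⟩ ((h | ⟨t, ht, h⟩) | h)
    · exact h (heO ⟨a, rfl⟩)
    · exact hpe t ht (h ▸ ⟨a, rfl⟩)
    · simp only [mem_ofPred_eq, hre, dist_self] at h
      exact absurd h (not_le.2 (by positivity)))
  rw [Set.disjoint_left] at h3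
  refine ⟨O', ⟨h1, h2⟩, fun x hx ↦ ?_, fun x hx ↦ ?_, fun a ↦ ⟨p (T j a), ⟨hpO _ ⟨a, rfl⟩, ?_⟩,
    hpT _ ⟨a, rfl⟩⟩⟩
  · by_contra h
    exact h3 hx (.inl (.inl h))
  · by_contra! h
    exact h3 hx (.inr h)
  · exact fun h ↦ h3 h (.inl (.inr ⟨_, ⟨a, rfl⟩, rfl⟩))

/-- The complement of the range of `e` is the union of the clopen shells `l = j`; these converge to
the range along the retraction `r`, and the `j`-th one meets every piece of the `j`-th partition. -/
structure IsShelling {X A τ : Type*} [TopologicalSpace X] [TopologicalSpace A] (T : ℕ → A → τ)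
    (e : A → X) (r : X → A) (l : X → ℕ) : Prop where
  continuous_retraction : Continuous r
  retraction_apply : ∀ a, r (e a) = a
  isClopen : ∀ j, IsClopen {x | x ∉ range e ∧ l x = j}
  exists_mem : ∀ j a, ∃ x ∉ range e, l x = j ∧ T j (r x) = T j a
  nhds : ∀ a, ∀ W ∈ 𝓝 (e a), ∃ J, ∀ x ∉ range e, J ≤ l x → T J (r x) = T J a → x ∈ W
  eventually_le : ∀ a J, ∀ᶠ x in 𝓝 (e a), x ∉ range e → J ≤ l x

/-- The complement of a closed nowhere dense copy of `A` in an ultrametric space has a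
shelling. -/
theorem IsNhdsTagging.exists_isShelling (hT : IsNhdsTagging T) (he : IsClosedEmbedding e)
    (hnd : interior (range e) = ∅) :
    ∃ (r : X → A) (l : X → ℕ), IsShelling T e r l := by
  classical
  obtain ⟨r₀, hr₀, hr₀e⟩ := IsUltrametricDist.exists_retraction he.isClosed_range (range_nonempty e)
  let φ := he.isEmbedding.toHomeomorph
  let r : X → A := φ.symm ∘ r₀
  have hr : Continuous r := φ.symm.continuous.comp hr₀
  have hre : ∀ a, r (e a) = a := fun a ↦ by
    have : r₀ (e a) = φ a := hr₀e ⟨e a, a, rfl⟩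
    simp [r, this]
  have step := fun (j : ℕ) (O : {O : Set X // IsClopen O ∧ range e ⊆ O}) ↦
    hT.exists_smaller_isClopen he hnd hr hre j O.2.1 O.2.2
  choose N hN hNO hNd hNT using step
  let O : ℕ → {O : Set X // IsClopen O ∧ range e ⊆ O} := fun n ↦
    Nat.rec ⟨univ, isClopen_univ, subset_univ _⟩ (fun j P ↦ ⟨N j P, hN j P⟩) n
  have hanti : Antitone fun j ↦ (O j).1 := antitone_nat_of_succ_le fun j ↦ hNO j (O j)
  have hd : ∀ j, ∀ x ∈ (O (j + 1)).1, dist x (e (r x)) < (1 / 2) ^ j := fun j ↦ hNd j (O j)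
  have hex : ∀ x ∉ range e, ∃ j, x ∉ (O (j + 1)).1 := by
    intro x hx
    by_contra! h
    have hpos : 0 < dist x (e (r x)) := dist_pos.2 fun h' ↦ hx ⟨_, h'.symm⟩
    obtain ⟨j, hj⟩ := exists_pow_lt_of_lt_one hpos (by norm_num : (1 / 2 : ℝ) < 1)
    exact absurd (hd j x (h j)) (not_lt.2 hj.le)
  -- Off the range this is the largest `j` with `x` in `O j`. The value 0 on the range is arbitrary
  -- and never matters.
  let l : X → ℕ := fun x ↦ if h : ∃ j, x ∉ (O (j + 1)).1 then Nat.find h else 0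
  have hl : ∀ x ∉ range e, ∀ j, j ≤ l x ↔ x ∈ (O j).1 := by
    intro x hx j
    have h := hex x hx
    have hlx : l x = Nat.find h := dif_pos h
    rw [hlx, Nat.le_find_iff]
    constructor
    · intro h'
      cases j with
      | zero => exact mem_univ x
      | succ j => exact not_not.1 (h' j (Nat.lt_succ_self j))
    · exact fun hj m hm ↦ not_not.2 (hanti (Nat.succ_le_of_lt hm) hj)
  have hl' : ∀ j, {x | x ∉ range e ∧ l x = j} = (O j).1 \ (O (j + 1)).1 := by
    intro j
    ext x
    constructor
    · rintro ⟨hx, rfl⟩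
      exact ⟨(hl x hx _).1 le_rfl, fun h ↦ absurd ((hl x hx (l x + 1)).2 h) (by simp)⟩
    · rintro ⟨h1, h2⟩
      have hx : x ∉ range e := fun hx ↦ h2 ((O (j + 1)).2.2 hx)
      have h3 := (hl x hx j).2 h1
      have h4 := mt (hl x hx (j + 1)).1 h2
      exact ⟨hx, by omega⟩
  refine ⟨r, l, hr, hre, fun j ↦ ?_, fun j a ↦ ?_, fun a W hW ↦ ?_, fun a J ↦ ?_⟩
  · rw [hl']
    exact (O j).2.1.diff (O (j + 1)).2.1
  · obtain ⟨x, hx, hxT⟩ := hNT j (O j) a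
    have hx : x ∈ {x | x ∉ range e ∧ l x = j} := (hl' j).symm ▸ hx
    exact ⟨x, hx.1, hx.2, hxT⟩
  · obtain ⟨ε, hε, hεW⟩ := Metric.mem_nhds_iff.1 hW
    obtain ⟨J, hJ⟩ := hT.nhds a _ (he.continuous.continuousAt (ball_mem_nhds (e a) hε))
    obtain ⟨k, hk⟩ := exists_pow_lt_of_lt_one hε (by norm_num : (1 / 2 : ℝ) < 1)
    -- One index must bound both the tag level and the shell. The `+ 1` appears because the bound
    -- `(1 / 2) ^ k` holds on `O (k + 1)`.
    refine ⟨max J (k + 1), fun x hx hxl hxT ↦ hεW ?_⟩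
    have h1 := hJ _ (hT.mono (le_max_left _ _) hxT)
    have h2 := hd k x ((hl x hx _).1 ((le_max_right _ _).trans hxl))
    exact (IsUltrametricDist.dist_triangle_max x (e (r x)) (e a)).trans_lt (max_lt (h2.trans hk) h1)
  · filter_upwards [(O J).2.1.isOpen.mem_nhds ((O J).2.2 ⟨a, rfl⟩)] with x hx hxe
    exact (hl x hxe J).2 hx

end Shells

/-! ### Matching the pieces of two shellings -/

section Extension

variable {X Y A τ : Type*} [TopologicalSpace X] [TopologicalSpace Y] [TopologicalSpace A]
  {T : ℕ → A → τ} {e : A → X} {r : X → A} {l : X → ℕ} {e' : A → Y} {r' : Y → A} {l' : Y → ℕ}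

/-- The piece of the shelling that a point outside the range of `e` belongs to. -/
def shellLabel (T : ℕ → A → τ) (e : A → X) (r : X → A) (l : X → ℕ)
    (x : ((range e)ᶜ : Set X)) : ℕ × τ :=
  (l x, T (l x) (r x))

omit [TopologicalSpace X] [TopologicalSpace A] in
theorem image_shellLabel_fiber (i : ℕ × τ) :
    Subtype.val '' (shellLabel T e r l ⁻¹' {i}) =
      {x | x ∉ range e ∧ l x = i.1} ∩ (fun x ↦ T i.1 (r x)) ⁻¹' {i.2} := by
  obtain ⟨j, t⟩ := i
  ext x
  constructor
  · rintro ⟨⟨x, hx⟩, h, rfl⟩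
    simp only [mem_preimage, mem_singleton_iff, shellLabel, Prod.mk.injEq] at h
    obtain ⟨rfl, rfl⟩ := h
    exact ⟨⟨hx, rfl⟩, rfl⟩
  · rintro ⟨⟨hx, rfl⟩, ht⟩
    exact ⟨⟨x, hx⟩, Prod.ext rfl ht, rfl⟩

theorem IsShelling.isClopen_image_fiber (hT : IsNhdsTagging T) (hs : IsShelling T e r l)
    (i : ℕ × τ) : IsClopen (Subtype.val '' (shellLabel T e r l ⁻¹' {i})) := by
  rw [image_shellLabel_fiber]
  exact (hs.isClopen i.1).inter (((hT.isLocallyConstant i.1).isClopen_fiber i.2).preimage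
    hs.continuous_retraction)

theorem IsShelling.isLocallyConstant_shellLabel (hT : IsNhdsTagging T) (hs : IsShelling T e r l) :
    IsLocallyConstant (shellLabel T e r l) := by
  rw [IsLocallyConstant.iff_isOpen_fiber]
  intro i
  have := (hs.isClopen_image_fiber hT i).isOpen.preimage
    (continuous_subtype_val (p := fun x ↦ x ∈ (range e)ᶜ))
  rwa [preimage_image_eq _ Subtype.val_injective] at this

/-- The criterion involves only the tagging of `A`, so two shellings with the same tagging have
nonempty pieces at the same labels. -/
theorem IsShelling.fiber_nonempty_iff (hs : IsShelling T e r l) (i : ℕ × τ) :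
    (shellLabel T e r l ⁻¹' {i}).Nonempty ↔ i.2 ∈ range (T i.1) := by
  obtain ⟨j, t⟩ := i
  constructor
  · rintro ⟨x, hx⟩
    simp only [mem_preimage, mem_singleton_iff, shellLabel, Prod.mk.injEq] at hx
    obtain ⟨rfl, rfl⟩ := hx
    exact ⟨_, rfl⟩
  · rintro ⟨a, ha⟩
    obtain ⟨x, hx, rfl, hxT⟩ := hs.exists_mem j a
    exact ⟨⟨x, hx⟩, Prod.ext rfl (hxT.trans ha)⟩

open Classical in
/-- The map that is given by `e' ∘ e⁻¹` on the range of `e` and by `g` outside. -/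
noncomputable def shellGlue (e : A → X) (r : X → A) (e' : A → Y)
    (g : ((range e)ᶜ : Set X) → ((range e')ᶜ : Set Y)) (x : X) : Y :=
  if h : x ∈ range e then e' (r x) else g ⟨x, h⟩

omit [TopologicalSpace Y] in
theorem IsShelling.shellGlue_apply (hs : IsShelling T e r l)
    (g : ((range e)ᶜ : Set X) → ((range e')ᶜ : Set Y)) (a : A) :
    shellGlue e r e' g (e a) = e' a := by
  simp [shellGlue, hs.retraction_apply]

omit [TopologicalSpace X] [TopologicalSpace Y] [TopologicalSpace A] in
theorem shellGlue_of_notMem (g : ((range e)ᶜ : Set X) → ((range e')ᶜ : Set Y)) {x : X}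
    (hx : x ∉ range e) : shellGlue e r e' g x = g ⟨x, hx⟩ := dif_neg hx

/-- Continuity is at stake only on the range. A point near `e a` but off the range lies in a late
shell and over the tag of `a`. Preservation of labels passes both facts to its image, which is
therefore near `e' a`. -/
theorem IsShelling.continuous_shellGlue (hT : IsNhdsTagging T) (hs : IsShelling T e r l)
    (hs' : IsShelling T e' r' l') (he : IsClosed (range e)) (he' : Continuous e')
    {g : ((range e)ᶜ : Set X) → ((range e')ᶜ : Set Y)} (hg : Continuous g)
    (hgl : ∀ x, shellLabel T e' r' l' (g x) = shellLabel T e r l x) :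
    Continuous (shellGlue e r e' g) := by
  rw [continuous_iff_continuousAt]
  intro x
  by_cases hx : x ∈ range e
  · obtain ⟨a, rfl⟩ := hx
    rw [ContinuousAt, hs.shellGlue_apply]
    refine tendsto_def.2 fun W hW ↦ ?_
    obtain ⟨J, hJ⟩ := hs'.nhds a W hW
    have h1 : ∀ᶠ x in 𝓝 (e a), e' (r x) ∈ W := by
      have := (he'.comp hs.continuous_retraction).continuousAt (x := e a)
      rw [ContinuousAt, Function.comp_apply, hs.retraction_apply] at this
      exact this hW
    have h2 : ∀ᶠ x in 𝓝 (e a), T J (r x) = T J a := by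
      have := ((hT.isLocallyConstant J {T J a}).preimage hs.continuous_retraction).mem_nhds
        (x := e a) (by simp [hs.retraction_apply])
      exact this
    filter_upwards [h1, h2, hs.eventually_le a J] with x h1 h2 h3
    by_cases hx : x ∈ range e
    · obtain ⟨b, rfl⟩ := hx
      rw [hs.retraction_apply] at h1
      rwa [mem_preimage, hs.shellGlue_apply]
    · rw [mem_preimage, shellGlue_of_notMem g hx]
      -- The tags agree at level `l x`, which is at least `J`; since the partitions refine one
      -- another, they agree at level `J`.
      have hl := congrArg Prod.fst (hgl ⟨x, hx⟩)
      have ht := congrArg Prod.snd (hgl ⟨x, hx⟩)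
      simp only [shellLabel] at hl ht
      rw [hl] at ht
      refine hJ _ (g ⟨x, hx⟩).2 (by rw [hl]; exact h3 hx) ?_
      rw [hT.mono (h3 hx) ht, h2]
  · have hx' : (⟨x, hx⟩ : ((range e)ᶜ : Set X)).1 = x := rfl
    rw [← hx', ← he.isOpen_compl.isOpenEmbedding_subtypeVal.continuousAt_iff]
    have : shellGlue e r e' g ∘ Subtype.val = fun x ↦ (g x : Y) :=
      funext fun y ↦ shellGlue_of_notMem g y.2
    rw [this]
    exact (continuous_subtype_val.comp hg).continuousAt

theorem IsShelling.shellGlue_shellGlue (hs : IsShelling T e r l) (hs' : IsShelling T e' r' l')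
    {g : ((range e)ᶜ : Set X) → ((range e')ᶜ : Set Y)}
    {g' : ((range e')ᶜ : Set Y) → ((range e)ᶜ : Set X)} (h : Function.LeftInverse g' g) :
    Function.LeftInverse (shellGlue e' r' e g') (shellGlue e r e' g) := by
  intro x
  by_cases hx : x ∈ range e
  · obtain ⟨a, rfl⟩ := hx
    rw [hs.shellGlue_apply, hs'.shellGlue_apply]
  · rw [shellGlue_of_notMem g hx, shellGlue_of_notMem g' (g ⟨x, hx⟩).2]
    exact congrArg Subtype.val (h ⟨x, hx⟩)

/-- If all nonempty clopen subsets of `X` are homeomorphic to `X`, then the canonical bijection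
between the ranges of two shelled closed embeddings into `X` extends to a homeomorphism of `X`. -/
theorem IsShelling.exists_homeomorph (hT : IsNhdsTagging T) {e' : A → X} {r' : X → A} {l' : X → ℕ}
    (hX : ∀ U : Set X, IsClopen U → U.Nonempty → Nonempty (U ≃ₜ X))
    (hs : IsShelling T e r l) (hs' : IsShelling T e' r' l') (he : IsClosedEmbedding e)
    (he' : IsClosedEmbedding e') : ∃ h : X ≃ₜ X, ∀ a, h (e a) = e' a := by
  have aux : ∀ {e : A → X} {r : X → A} {l : X → ℕ}, IsShelling T e r l → ∀ i : ℕ × τ,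
      i.2 ∈ range (T i.1) → Nonempty ((shellLabel T e r l ⁻¹' {i}) ≃ₜ X) := by
    intro e r l hs i hi
    obtain ⟨k⟩ := hX _ (hs.isClopen_image_fiber hT i)
      (((hs.fiber_nonempty_iff i).2 hi).image _)
    exact ⟨(IsEmbedding.subtypeVal.homeomorphImage _).trans k⟩
  obtain ⟨g, hg⟩ := exists_homeomorph_of_fibers (hs.isLocallyConstant_shellLabel hT)
      (hs'.isLocallyConstant_shellLabel hT) (fun i ↦ by
    by_cases hi : i.2 ∈ range (T i.1)
    · obtain ⟨k⟩ := aux hs i hi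
      obtain ⟨k'⟩ := aux hs' i hi
      exact ⟨k.trans k'.symm⟩
    · have h1 := mt (hs.fiber_nonempty_iff i).1 hi
      have h2 := mt (hs'.fiber_nonempty_iff i).1 hi
      rw [not_nonempty_iff_eq_empty] at h1 h2
      rw [h1, h2]
      exact ⟨.ofDiscrete (.equivOfIsEmpty _ _)⟩)
  have hg' : ∀ x, shellLabel T e r l (g.symm x) = shellLabel T e' r' l' x := fun x ↦ by
    rw [← hg, g.apply_symm_apply]
  exact ⟨⟨⟨shellGlue e r e' g, shellGlue e' r' e g.symm, hs.shellGlue_shellGlue hs' g.left_inv,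
    hs'.shellGlue_shellGlue hs g.right_inv⟩,
    hs.continuous_shellGlue hT hs' he.isClosed_range he'.continuous g.continuous hg,
    hs'.continuous_shellGlue hT hs he'.isClosed_range he.continuous g.symm.continuous hg'⟩,
    hs.shellGlue_apply g⟩

end Extension

/-! ### Subspaces of the Cantor space and the extension theorem -/

/-- The tag at level `j` encodes the first `j` bits as the set of positions holding `true`, so the
pieces are preimages of cylinders. -/
theorem Topology.IsInducing.isNhdsTagging {A : Type*} [TopologicalSpace A] {c : A → ℕ → Bool}
    (hc : IsInducing c) : IsNhdsTagging fun j a ↦ (Finset.range j).filter (c a · = true) := by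
  have key : ∀ {j a b}, (Finset.range j).filter (c a · = true) =
      (Finset.range j).filter (c b · = true) ↔ ∀ i < j, c a i = c b i := by
    intro j a b
    simp only [Finset.ext_iff, Finset.mem_filter, Finset.mem_range, and_congr_right_iff]
    exact forall₂_congr fun i _ ↦ Bool.eq_iff_iff.symm
  refine ⟨fun j ↦ ?_, fun j ↦ ?_, fun hij h ↦ ?_, fun a W hW ↦ ?_⟩
  · rw [IsLocallyConstant.iff_eventually_eq]
    intro a
    simp only [key]
    have : ∀ i, ∀ᶠ b in 𝓝 a, c b i = c a i := fun i ↦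
      ((continuous_apply i).comp hc.continuous).continuousAt.eventually
        (mem_nhds_discrete.2 rfl : {c a i} ∈ 𝓝 (c a i))
    exact ((Finset.range j).eventually_all.2 fun i _ ↦ this i).mono
      fun b hb i hi ↦ hb i (Finset.mem_range.2 hi)
  · refine (Finset.finite_toSet (Finset.range j).powerset).subset ?_
    rintro _ ⟨a, rfl⟩
    exact Finset.mem_powerset.2 (Finset.filter_subset _ _)
  · rw [key] at h ⊢
    exact fun i hi ↦ h i (hi.trans_le hij)
  · rw [hc.nhds_eq_comap, mem_comap] at hW
    obtain ⟨V, hV, hVW⟩ := hW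
    obtain ⟨_, ⟨x, j, rfl⟩, hx, hxV⟩ :=
      (PiNat.isTopologicalBasis_cylinders (fun _ ↦ Bool)).mem_nhds_iff.1 hV
    refine ⟨j, fun b hb ↦ hVW (hxV ?_)⟩
    rw [key] at hb
    intro i hi
    rw [hb i hi, hx i hi]

/-- If `X` embeds into the Cantor space and all its nonempty clopen subsets are homeomorphic to it,
then homeomorphisms between closed nowhere dense subsets of `X` extend to `X`. -/
theorem exists_homeomorph_extension {X : Type*} [TopologicalSpace X] {c : X → ℕ → Bool}
    (hc : IsEmbedding c) (hX : ∀ U : Set X, IsClopen U → U.Nonempty → Nonempty (U ≃ₜ X))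
    {F G : Set X} (hF : IsClosed F) (hF' : IsNowhereDense F) (hG : IsClosed G)
    (hG' : IsNowhereDense G) (f : F ≃ₜ G) : ∃ h : X ≃ₜ X, ∀ x : F, h (x : X) = (f x : X) := by
  rcases isEmpty_or_nonempty F with hemp | hne
  · exact ⟨.refl X, fun x ↦ hemp.elim x⟩
  let : MetricSpace (ℕ → Bool) := PiNat.metricSpace
  let : MetricSpace X := hc.comapMetricSpace c
  have : IsUltrametricDist X := ⟨fun x y z ↦ PiNat.dist_triangle_nonarch (c x) (c y) (c z)⟩
  -- This one tagging of `F` serves both the inclusion of `F` and its composite with `f`, which is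
  -- what makes the labels comparable.
  have hT := (hc.isInducing.comp (IsInducing.subtypeVal (t := F))).isNhdsTagging
  have he : IsClosedEmbedding (Subtype.val : F → X) := hF.isClosedEmbedding_subtypeVal
  have he' : IsClosedEmbedding fun x : F ↦ (f x : X) :=
    hG.isClosedEmbedding_subtypeVal.comp f.isClosedEmbedding
  have hr : range (fun x : F ↦ (f x : X)) = G :=
    (f.surjective.range_comp Subtype.val).trans Subtype.range_val
  obtain ⟨r, l, hs⟩ := hT.exists_isShelling he
    (by rwa [Subtype.range_val, ← hF.isNowhereDense_iff])
  obtain ⟨r', l', hs'⟩ := hT.exists_isShelling he' (by rwa [hr, ← hG.isNowhereDense_iff])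
  exact hs.exists_homeomorph hT hX hs' he he'

/-- A clopen subset splits off an open set as a topological summand. -/
theorem nonempty_homeomorph_sum_diff {X : Type*} [TopologicalSpace X] {U W : Set X}
    (hU : IsClopen U) (hW : IsOpen W) (h : U ⊆ W) : Nonempty (W ≃ₜ U ⊕ (W \ U : Set X)) := by
  classical
  let φ := Equiv.Set.sumDiffSubset h
  have hφ : (φ : U ⊕ (W \ U : Set X) → W) = Sum.elim (inclusion h) (inclusion sdiff_subset) := by
    funext x; cases x <;> rfl
  refine ⟨(φ.toHomeomorphOfContinuousOpen ?_ ?_).symm⟩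
  · rw [hφ]
    exact (continuous_inclusion h).sumElim (continuous_inclusion sdiff_subset)
  · rw [hφ, isOpenMap_sumElim]
    exact ⟨hU.isOpen.isOpenMap_inclusion h,
      (hW.sdiff hU.isClosed).isOpenMap_inclusion sdiff_subset⟩

/-! ### Absorption of topological summands -/

section Absorption

variable {X U V : Type*} [TopologicalSpace X] [TopologicalSpace U] [TopologicalSpace V]

/-- Adding one more copy to a countable sum of copies does not change it. -/
def sumNatProdHomeomorph (X : Type*) [TopologicalSpace X] : X ⊕ (ℕ × X) ≃ₜ ℕ × X :=
  (Homeomorph.sumComm X (ℕ × X)).trans <|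
    (Homeomorph.sumCongr (.refl _) (Homeomorph.uniqueProd PUnit.{1} X).symm).trans <|
      Homeomorph.sumProdDistrib.symm.trans <|
        (Homeomorph.ofDiscrete Equiv.natSumPUnitEquivNat).prodCongr (.refl X)

/-- A space homeomorphic to its countable multiple absorbs each of its topological summands. -/
def sumHomeomorphOfNatProd (h : ℕ × X ≃ₜ X) (k : X ≃ₜ U ⊕ V) : U ⊕ X ≃ₜ X :=
  -- Multiplying the splitting by `ℕ` exhibits countably many copies of `U` inside `X`, and these
  -- swallow one more.
  let k' : X ≃ₜ (ℕ × U) ⊕ (ℕ × V) :=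
    h.symm.trans <| ((Homeomorph.refl ℕ).prodCongr k).trans Homeomorph.prodSumDistrib
  ((Homeomorph.refl U).sumCongr k').trans <| (Homeomorph.sumAssoc _ _ _).symm.trans <|
    ((sumNatProdHomeomorph U).sumCongr (.refl _)).trans k'.symm

end Absorption

/-- Every point has arbitrarily small clopen neighbourhoods homeomorphic to the whole space. -/
def LocallySelfSimilar (X : Type*) [TopologicalSpace X] : Prop :=
  ∀ (x : X) (U : Set X), IsOpen U → x ∈ U →
    ∃ V : Set X, IsClopen V ∧ x ∈ V ∧ V ⊆ U ∧ Nonempty (V ≃ₜ X)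

/-! ### Locally self-similar spaces -/

namespace LocallySelfSimilar

variable {X Y : Type*} [TopologicalSpace X] [TopologicalSpace Y]

theorem prod (hX : LocallySelfSimilar X) (hY : LocallySelfSimilar Y) :
    LocallySelfSimilar (X × Y) := by
  rintro ⟨x, y⟩ U hU hxy
  obtain ⟨A, B, hA, hB, hxA, hyB, hAB⟩ := isOpen_prod_iff.1 hU x y hxy
  obtain ⟨V, hV, hxV, hVA, ⟨f⟩⟩ := hX x A hA hxA
  obtain ⟨W, hW, hyW, hWB, ⟨g⟩⟩ := hY y B hB hyB
  exact ⟨V ×ˢ W, hV.prod hW, ⟨hxV, hyW⟩, (prod_mono hVA hWB).trans hAB,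
    ⟨(Homeomorph.Set.prod V W).trans (f.prodCongr g)⟩⟩

theorem of_homeomorph (hX : LocallySelfSimilar X) (e : X ≃ₜ Y) : LocallySelfSimilar Y := by
  intro y U hU hy
  obtain ⟨V, hV, hxV, hVU, ⟨f⟩⟩ := hX (e.symm y) (e ⁻¹' U) (hU.preimage e.continuous) (by simpa)
  refine ⟨e '' V, ⟨e.isClosedMap _ hV.isClosed, e.isOpenMap _ hV.isOpen⟩,
    ⟨_, hxV, e.apply_symm_apply y⟩, image_subset_iff.2 hVU, ⟨(e.image V).symm.trans (f.trans e)⟩⟩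

/-- The indicator functions of a countable clopen basis are the coordinates of the embedding. -/
theorem exists_isEmbedding [SecondCountableTopology X] [T0Space X] (hX : LocallySelfSimilar X) :
    ∃ c : X → ℕ → Bool, IsEmbedding c := by
  classical
  have hB : TopologicalSpace.IsTopologicalBasis {s : Set X | IsClopen s} :=
    TopologicalSpace.isTopologicalBasis_of_isOpen_of_nhds (fun s hs ↦ hs.isOpen) fun x U hx hU ↦
      let ⟨V, hV, hxV, hVU, _⟩ := hX x U hU hx
      ⟨V, hV, hxV, hVU⟩
  obtain ⟨B, hBc, hBcl, hBb⟩ := hB.exists_countable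
  -- Adding `∅` makes the family nonempty, so that it can be enumerated by `ℕ`.
  obtain ⟨b, hb⟩ := (hBcl.insert ∅).exists_eq_range (insert_nonempty _ _)
  have hclopen : ∀ n, IsClopen (b n) := fun n ↦ by
    have : b n ∈ insert ∅ B := hb ▸ mem_range_self n
    rcases this with h | h
    · rw [h]; exact isClopen_empty
    · exact hBc h
  have hcont : Continuous fun x n ↦ boolIndicator (b n) x :=
    continuous_pi fun n ↦ (continuous_boolIndicator_iff_isClopen _).2 (hclopen n)
  refine ⟨fun x n ↦ boolIndicator (b n) x, IsInducing.isEmbedding (isInducing_iff_nhds.2 fun x ↦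
    le_antisymm hcont.continuousAt.le_comap fun W hW ↦ ?_)⟩
  obtain ⟨t, ht, hxt, htW⟩ := hBb.mem_nhds_iff.1 hW
  obtain ⟨n, rfl⟩ : t ∈ range b := hb ▸ mem_insert_of_mem _ ht
  refine ⟨(fun f : ℕ → Bool ↦ f n) ⁻¹' {true}, ?_, fun y hy ↦ htW ?_⟩
  · exact ((isOpen_discrete _).preimage (continuous_apply n)).mem_nhds
      ((mem_iff_boolIndicator _ _).1 hxt)
  · exact (mem_iff_boolIndicator _ _).2 hy

/-- An isolated point would contain a copy of the whole space, which has at least two points. -/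
theorem isNowhereDense_singleton [T1Space X] [Nontrivial X] (hX : LocallySelfSimilar X) (x : X) :
    IsNowhereDense ({x} : Set X) := by
  rw [isClosed_singleton.isNowhereDense_iff, eq_empty_iff_forall_notMem]
  intro y hy
  obtain ⟨V, -, -, hVx, ⟨f⟩⟩ := hX y _ isOpen_interior hy
  obtain ⟨a, b, hab⟩ := exists_pair_ne X
  apply hab
  apply f.symm.injective
  exact Subtype.ext (((hVx.trans interior_subset) (f.symm a).2).trans
    ((hVx.trans interior_subset) (f.symm b).2).symm)

theorem nowhereDenseHomogeneous [SecondCountableTopology X] [T1Space X] [Nontrivial X]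
    (hX : LocallySelfSimilar X)
    (h : ∀ U : Set X, IsClopen U → U.Nonempty → Nonempty (U ≃ₜ X)) :
    NowhereDenseHomogeneous X := by
  obtain ⟨x, -⟩ := exists_pair_ne X
  obtain ⟨c, hc⟩ := hX.exists_isEmbedding
  exact ⟨⟨{x}, singleton_nonempty x, isClosed_singleton, hX.isNowhereDense_singleton x⟩,
    fun F G hF hF' hG hG' f ↦ exists_homeomorph_extension hc h hF hF' hG hG' f⟩

/-- With `R = U \ V` for a copy `V` of `X` inside `U`, one has `U ≅ X ⊕ R ≅ (X ⊕ X) ⊕ R ≅ X ⊕ (X ⊕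
R) ≅ X ⊕ U ≅ X`. The last step is absorption, as `U` is a summand of `X`. -/
theorem nonempty_homeomorph_of_isClopen (hX : LocallySelfSimilar X) (h : ℕ × X ≃ₜ X) {U : Set X}
    (hU : IsClopen U) (hne : U.Nonempty) : Nonempty (U ≃ₜ X) := by
  obtain ⟨x, hx⟩ := hne
  obtain ⟨V, hV, -, hVU, ⟨f⟩⟩ := hX x U hU.isOpen hx
  obtain ⟨s⟩ := nonempty_homeomorph_sum_diff hV hU.isOpen hVU
  obtain ⟨t⟩ := nonempty_homeomorph_sum_diff hU isOpen_univ (subset_univ U)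
  have u : U ⊕ X ≃ₜ X := sumHomeomorphOfNatProd h ((Homeomorph.Set.univ X).symm.trans t)
  have v : X ⊕ X ≃ₜ X :=
    ((Homeomorph.refl X).sumCongr h.symm).trans ((sumNatProdHomeomorph X).trans h)
  have s' : U ≃ₜ X ⊕ (U \ V : Set X) := s.trans (f.sumCongr (.refl _))
  exact ⟨s'.trans <| (v.symm.sumCongr (.refl _)).trans <| (Homeomorph.sumAssoc _ _ _).trans <|
    ((Homeomorph.refl X).sumCongr s'.symm).trans <| (Homeomorph.sumComm _ _).trans u⟩

theorem nowhereDenseHomogeneous_of_natProd [SecondCountableTopology X] [T1Space X] [Nonempty X]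
    (hX : LocallySelfSimilar X) (h : Nonempty (ℕ × X ≃ₜ X)) : NowhereDenseHomogeneous X := by
  obtain ⟨h⟩ := h
  have : Nontrivial X := h.symm.toEquiv.nontrivial
  exact hX.nowhereDenseHomogeneous fun U hU hne ↦ hX.nonempty_homeomorph_of_isClopen h hU hne

end LocallySelfSimilar

theorem nonempty_natProd_prod {X Y : Type*} [TopologicalSpace X] [TopologicalSpace Y]
    (h : Nonempty (ℕ × Y ≃ₜ Y)) : Nonempty (ℕ × (X × Y) ≃ₜ X × Y) := by
  obtain ⟨h⟩ := h
  exact ⟨(Homeomorph.prodAssoc ℕ X Y).symm.trans <|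
    ((Homeomorph.prodComm ℕ X).prodCongr (.refl Y)).trans <|
    (Homeomorph.prodAssoc X ℕ Y).trans <| (Homeomorph.refl X).prodCongr h⟩

/-! ### Clopen subsets of the Cantor space -/

section CantorSpace

open PiNat

/-- Cylinders of the Cantor space are homeomorphic to the Cantor space. -/
def cylinderHomeomorph (x : ℕ → Bool) (n : ℕ) : cylinder (E := fun _ ↦ Bool) x n ≃ₜ (ℕ → Bool) where
  toFun y i := y.1 (i + n)
  invFun z := ⟨fun i ↦ if i < n then x i else z (i - n), fun i hi ↦ by simp [hi]⟩
  left_inv y := by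
    ext i
    dsimp only
    split_ifs with h
    · exact (y.2 i h).symm
    · rw [Nat.sub_add_cancel (not_lt.1 h)]
  right_inv z := by
    ext i
    simp
  continuous_toFun := continuous_pi fun i ↦ (continuous_apply _).comp continuous_subtype_val
  continuous_invFun := by
    refine Continuous.subtype_mk (continuous_pi fun i ↦ ?_) _
    split_ifs
    · exact continuous_const
    · exact continuous_apply _

theorem isClopen_cylinder_bool (x : ℕ → Bool) (n : ℕ) :
    IsClopen (cylinder (E := fun _ ↦ Bool) x n) := by
  refine ⟨?_, isOpen_cylinder _ x n⟩
  rw [cylinder_eq_pi]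
  exact isClosed_set_pi fun _ _ ↦ isClosed_discrete _

theorem locallySelfSimilar_cantorSpace : LocallySelfSimilar (ℕ → Bool) := by
  intro x U hU hx
  obtain ⟨_, ⟨y, n, rfl⟩, hxy, hyU⟩ :=
    (isTopologicalBasis_cylinders (fun _ ↦ Bool)).exists_subset_of_mem_open hx hU
  exact ⟨_, isClopen_cylinder_bool y n, hxy, hyU, ⟨cylinderHomeomorph y n⟩⟩

theorem nonempty_cantorSpace_homeomorph_sum :
    Nonempty ((ℕ → Bool) ≃ₜ (ℕ → Bool) ⊕ (ℕ → Bool)) := by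
  obtain ⟨s⟩ := nonempty_homeomorph_sum_diff (isClopen_cylinder_bool (fun _ ↦ false) 1) isOpen_univ
    (subset_univ _)
  have : univ \ cylinder (E := fun _ ↦ Bool) (fun _ ↦ false) 1 = cylinder (fun _ ↦ true) 1 := by
    ext x
    simp [mem_cylinder_iff]
  rw [this] at s
  exact ⟨(Homeomorph.Set.univ _).symm.trans <|
    s.trans ((cylinderHomeomorph _ 1).sumCongr (cylinderHomeomorph _ 1))⟩

/-- Compactness makes the depth of the cylinders uniform, so that a clopen set is a finite union of
cylinders of one depth. -/
theorem exists_cylinder_subset_of_isClopen {U : Set (ℕ → Bool)} (hU : IsClopen U) :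
    ∃ n, ∀ x ∈ U, cylinder (E := fun _ ↦ Bool) x n ⊆ U := by
  refine hU.isClosed.isCompact.induction_on (p := fun s ↦ ∃ n, ∀ x ∈ s,
    cylinder (E := fun _ ↦ Bool) x n ⊆ U) ⟨0, by simp⟩ ?_ ?_ ?_
  · rintro s t hst ⟨n, hn⟩
    exact ⟨n, fun x hx ↦ hn x (hst hx)⟩
  · rintro s t ⟨n, hn⟩ ⟨m, hm⟩
    refine ⟨max n m, fun x hx ↦ ?_⟩
    rcases hx with hx | hx
    · exact (cylinder_anti x (le_max_left n m)).trans (hn x hx)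
    · exact (cylinder_anti x (le_max_right n m)).trans (hm x hx)
  · intro x hx
    obtain ⟨_, ⟨y, n, rfl⟩, hxy, hyU⟩ :=
      (isTopologicalBasis_cylinders (fun _ ↦ Bool)).exists_subset_of_mem_open hx hU.isOpen
    refine ⟨_, mem_nhdsWithin_of_mem_nhds ((isOpen_cylinder _ y n).mem_nhds hxy), n,
      fun z hz ↦ ?_⟩
    rwa [mem_cylinder_iff_eq.1 hz]

/-- Cylinders of equal depth are equal or disjoint, and two disjoint copies of the Cantor space
merge into one. The absorption argument is not available here: by compactness the Cantor space is
not homeomorphic to its product with `ℕ`. -/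
theorem nonempty_homeomorph_cantorSpace_of_isClopen {U : Set (ℕ → Bool)} (hU : IsClopen U)
    (hne : U.Nonempty) : Nonempty (U ≃ₜ (ℕ → Bool)) := by
  obtain ⟨n, hn⟩ := exists_cylinder_subset_of_isClopen hU
  let K : Set (Set (ℕ → Bool)) := (fun x ↦ cylinder (E := fun _ ↦ Bool) x n) '' U
  have hK : K.Finite := by
    refine (finite_range fun s : Fin n → Bool ↦ {y : ℕ → Bool | ∀ i : Fin n, y i = s i}).subset ?_
    rintro _ ⟨x, -, rfl⟩
    refine ⟨fun i ↦ x i, ?_⟩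
    ext y
    simp [mem_cylinder_iff, Fin.forall_iff]
  have hUK : ⋃₀ K = U := by
    ext x
    constructor
    · rintro ⟨_, ⟨y, hy, rfl⟩, hx⟩
      exact hn y hy hx
    · exact fun hx ↦ ⟨_, ⟨x, hx, rfl⟩, self_mem_cylinder x n⟩
  have key : IsClopen (⋃₀ K) ∧ (⋃₀ K = ∅ ∨ Nonempty ((⋃₀ K) ≃ₜ (ℕ → Bool))) := by
    refine hK.induction_on_subset (motive := fun S _ ↦ IsClopen (⋃₀ S) ∧
      (⋃₀ S = ∅ ∨ Nonempty ((⋃₀ S) ≃ₜ (ℕ → Bool)))) _ ?_ ?_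
    · simp [isClopen_empty]
    · rintro s S ⟨x, hx, rfl⟩ hS hs ⟨h1, h2⟩
      dsimp only at hs ⊢
      rw [sUnion_insert]
      have hc := isClopen_cylinder_bool x n
      refine ⟨hc.union h1, .inr ?_⟩
      rcases h2 with h2 | ⟨⟨f⟩⟩
      · rw [h2, union_empty]
        exact ⟨cylinderHomeomorph x n⟩
      · obtain ⟨g⟩ := nonempty_homeomorph_sum_diff hc (hc.union h1).isOpen subset_union_left
        have hd : (cylinder (E := fun _ ↦ Bool) x n ∪ ⋃₀ S) \ cylinder x n = ⋃₀ S := by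
          rw [union_sdiff_left, sdiff_eq_left, Set.disjoint_left]
          rintro z ⟨t, ht, hzt⟩ hzx
          obtain ⟨y, -, rfl⟩ := hS ht
          apply hs
          rwa [← mem_cylinder_iff_eq.1 hzx, mem_cylinder_iff_eq.1 hzt]
        rw [hd] at g
        obtain ⟨k⟩ := nonempty_cantorSpace_homeomorph_sum
        exact ⟨g.trans (((cylinderHomeomorph x n).sumCongr f).trans k.symm)⟩
  rw [hUK] at key
  exact key.2.resolve_left hne.ne_empty

end CantorSpace

/-! ### Subspaces of the line cut at points they omit -/

section RealSubspaces

variable {Y : Type*} [TopologicalSpace Y] {e : Y → ℝ} {E : Set ℝ}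

/-- Since `e` misses the endpoints, the open and the closed interval have the same preimage. -/
theorem isClopen_preimage_Ioo (he : Continuous e) (heE : ∀ y, e y ∉ E) {a b : ℝ} (ha : a ∈ E)
    (hb : b ∈ E) : IsClopen (e ⁻¹' Ioo a b) := by
  refine ⟨?_, isOpen_Ioo.preimage he⟩
  have : e ⁻¹' Ioo a b = e ⁻¹' Icc a b := by
    ext y
    have h1 : a ≠ e y := fun h ↦ heE y (h ▸ ha)
    have h2 : e y ≠ b := fun h ↦ heE y (h ▸ hb)
    simp [h1.le_iff_lt, h2.le_iff_lt]
  rw [this]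
  exact isClosed_Icc.preimage he

theorem locallySelfSimilar_of_isInducing_real (he : IsInducing e) (hE : Dense E)
    (heE : ∀ y, e y ∉ E)
    (h : ∀ a ∈ E, ∀ b ∈ E, a < b → Nonempty ((e ⁻¹' Ioo a b) ≃ₜ Y)) : LocallySelfSimilar Y := by
  intro y U hU hy
  obtain ⟨V, hV, rfl⟩ := he.isOpen_iff.1 hU
  obtain ⟨ε, hε, hεV⟩ := Metric.isOpen_iff.1 hV (e y) hy
  rw [Real.ball_eq_Ioo] at hεV
  obtain ⟨a, haE, ha⟩ := hE.exists_between (show e y - ε < e y by linarith)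
  obtain ⟨b, hbE, hb⟩ := hE.exists_between (show e y < e y + ε by linarith)
  exact ⟨e ⁻¹' Ioo a b, isClopen_preimage_Ioo he.continuous heE haE hbE, ⟨ha.2, hb.1⟩,
    preimage_mono ((Ioo_subset_Ioo ha.1.le hb.2.le).trans hεV), h a haE b hbE (ha.2.trans hb.1)⟩

/-- The omitted points `α + n` cut `Y` into clopen pieces indexed by `ℤ`, each a copy of `Y`. -/
theorem nonempty_natProd_of_real (he : Continuous e) (heE : ∀ y, e y ∉ E)
    (h : ∀ a ∈ E, ∀ b ∈ E, a < b → Nonempty ((e ⁻¹' Ioo a b) ≃ₜ Y)) {α : ℝ}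
    (hα : ∀ n : ℤ, α + n ∈ E) : Nonempty (ℕ × Y ≃ₜ Y) := by
  have hfib : ∀ n : ℤ, (fun y ↦ ⌊e y - α⌋) ⁻¹' {n} = e ⁻¹' Ioo (α + n) (α + (n + 1 : ℤ)) := by
    intro n
    ext y
    have h1 : α + n ≠ e y := fun h ↦ heE y (h ▸ hα n)
    simp only [mem_preimage, mem_singleton_iff, Int.floor_eq_iff, mem_Ioo]
    rw [← h1.le_iff_lt]
    push_cast
    constructor <;> rintro ⟨h1, h2⟩ <;> constructor <;> linarith
  have hlc : IsLocallyConstant fun y ↦ ⌊e y - α⌋ := by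
    rw [IsLocallyConstant.iff_isOpen_fiber]
    intro n
    rw [hfib]
    exact isOpen_Ioo.preimage he
  have hlc' : IsLocallyConstant (Prod.fst : ℤ × Y → ℤ) :=
    fun s ↦ (isOpen_discrete s).preimage continuous_fst
  obtain ⟨g, -⟩ := exists_homeomorph_of_fibers hlc' hlc fun n ↦ by
    rw [hfib]
    obtain ⟨k⟩ := h _ (hα n) _ (hα (n + 1)) (by simp)
    have : (Prod.fst : ℤ × Y → ℤ) ⁻¹' {n} = {n} ×ˢ univ := by ext; simp
    rw [this]
    exact ⟨(Homeomorph.Set.prod _ _).trans <| (Homeomorph.uniqueProd _ _).trans <|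
      (Homeomorph.Set.univ Y).trans k.symm⟩
  exact ⟨((Homeomorph.ofDiscrete (Denumerable.eqv ℤ).symm).prodCongr (.refl Y)).trans g⟩

end RealSubspaces

theorem nonempty_homeomorph_rat_Ioo {a b : ℝ} (hab : a < b) :
    Nonempty (((fun q : ℚ ↦ (q : ℝ)) ⁻¹' Ioo a b) ≃ₜ ℚ) := by
  let S : Set ℚ := (fun q : ℚ ↦ (q : ℝ)) ⁻¹' Ioo a b
  -- Order-connectedness makes the subspace topology the order topology, so the order isomorphism
  -- from Cantor's theorem on countable dense orders is a homeomorphism.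
  have hoc : S.OrdConnected := ⟨fun x hx y hy z hz ↦
    ⟨hx.1.trans_le (Rat.cast_le.2 hz.1), (Rat.cast_le.2 hz.2).trans_lt hy.2⟩⟩
  obtain ⟨q, hq⟩ := exists_rat_btwn hab
  have : Nonempty S := ⟨q, hq⟩
  have : NoMinOrder S := ⟨fun ⟨x, hx⟩ ↦ by
    obtain ⟨q, hq⟩ := exists_rat_btwn hx.1
    exact ⟨⟨q, hq.1, hq.2.trans hx.2⟩, Rat.cast_lt.1 hq.2⟩⟩
  have : NoMaxOrder S := ⟨fun ⟨x, hx⟩ ↦ by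
    obtain ⟨q, hq⟩ := exists_rat_btwn hx.2
    exact ⟨⟨q, hx.1.trans hq.1, hq.2⟩, Rat.cast_lt.1 hq.1⟩⟩
  have : DenselyOrdered S := inferInstance
  obtain ⟨f⟩ := Order.iso_of_countable_dense S ℚ
  exact ⟨f.toHomeomorph⟩

theorem locallySelfSimilar_rat : LocallySelfSimilar ℚ :=
  locallySelfSimilar_of_isInducing_real Rat.isEmbedding_coe_real.isInducing dense_irrational
    (fun q ↦ q.not_irrational) fun _ _ _ _ ↦ nonempty_homeomorph_rat_Ioo

theorem nonempty_natProd_rat : Nonempty (ℕ × ℚ ≃ₜ ℚ) :=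
  nonempty_natProd_of_real (E := {x | Irrational x}) Rat.continuous_coe_real
    (fun q ↦ q.not_irrational) (fun _ _ _ _ ↦ nonempty_homeomorph_rat_Ioo)
    fun n ↦ irrational_sqrt_two.add_intCast n

/-! ### Rational intervals of irrational numbers -/

section Irrational

/-- A homeomorphism of the real line onto the interval between `a` and `b`. -/
noncomputable def squeeze (a b x : ℝ) : ℝ := (a + b) / 2 + (b - a) / 2 * (x / (1 + |x|))

/-- The inverse of `squeeze a b` on the interval between `a` and `b`. -/
noncomputable def unsqueeze (a b x : ℝ) : ℝ :=
  (2 * x - a - b) / (b - a) / (1 - |(2 * x - a - b) / (b - a)|)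

variable {a b x : ℝ}

theorem abs_lt_one_of_mem_Ioo (hx : x ∈ Ioo a b) : |(2 * x - a - b) / (b - a)| < 1 := by
  have hab : 0 < b - a := by linarith [hx.1, hx.2]
  rw [abs_lt, lt_div_iff₀ hab, div_lt_iff₀ hab]
  constructor <;> linarith [hx.1, hx.2]

theorem squeeze_mem_Ioo (hab : a < b) (x : ℝ) : squeeze a b x ∈ Ioo a b := by
  have h0 : 0 < 1 + |x| := by positivity
  have h1 : -1 < x / (1 + |x|) := by rw [lt_div_iff₀ h0]; linarith [neg_abs_le x]
  have h2 : x / (1 + |x|) < 1 := by rw [div_lt_one h0]; linarith [le_abs_self x]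
  unfold squeeze
  constructor <;> nlinarith

theorem unsqueeze_squeeze (hab : a < b) (x : ℝ) : unsqueeze a b (squeeze a b x) = x := by
  have h1 : (2 * squeeze a b x - a - b) / (b - a) = x / (1 + |x|) := by
    have : b - a ≠ 0 := by linarith
    rw [div_eq_iff this, squeeze]
    ring
  have hx : 0 < 1 + |x| := by positivity
  rw [unsqueeze, h1, abs_div, abs_of_pos hx]
  field_simp
  ring

theorem squeeze_unsqueeze (hx : x ∈ Ioo a b) : squeeze a b (unsqueeze a b x) = x := by
  have hab : b - a ≠ 0 := by linarith [hx.1, hx.2]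
  have h := abs_lt_one_of_mem_Ioo hx
  have h2 : x = (a + b) / 2 + (b - a) / 2 * ((2 * x - a - b) / (b - a)) := by
    field_simp; ring
  rw [squeeze, unsqueeze]
  generalize (2 * x - a - b) / (b - a) = u at h h2
  have h3 : 0 < 1 - |u| := by linarith
  rw [h2, abs_div, abs_of_pos h3]
  congr 2
  field_simp
  ring

theorem continuous_squeeze : Continuous (squeeze a b) := by
  unfold squeeze
  exact continuous_const.add (continuous_const.mul
    (continuous_id.div (by fun_prop) fun x ↦ by positivity))

theorem continuousOn_unsqueeze : ContinuousOn (unsqueeze a b) (Ioo a b) := by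
  unfold unsqueeze
  refine ContinuousOn.div (by fun_prop) (by fun_prop) fun x hx ↦ ?_
  linarith [abs_lt_one_of_mem_Ioo hx]

/-- The formula uses only field operations and the absolute value. With rational endpoints it and
its inverse therefore preserve rationality, and being mutually inverse they also preserve
irrationality. -/
theorem squeeze_ratCast (p q r : ℚ) : squeeze p q r ∈ range ((↑) : ℚ → ℝ) :=
  ⟨(p + q) / 2 + (q - p) / 2 * (r / (1 + |r|)), by push_cast [squeeze]; rfl⟩

theorem unsqueeze_ratCast (p q r : ℚ) : unsqueeze p q r ∈ range ((↑) : ℚ → ℝ) :=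
  ⟨(2 * r - p - q) / (q - p) / (1 - |(2 * r - p - q) / (q - p)|), by push_cast [unsqueeze]; rfl⟩

theorem Irrational.squeeze {p q : ℚ} (hpq : (p : ℝ) < q) (hx : Irrational x) :
    Irrational (squeeze p q x) := by
  rintro ⟨r, hr⟩
  apply hx
  rw [← unsqueeze_squeeze hpq x, ← hr]
  exact unsqueeze_ratCast p q r

theorem Irrational.unsqueeze {p q : ℚ} (hxpq : x ∈ Ioo (p : ℝ) q) (hx : Irrational x) :
    Irrational (unsqueeze p q x) := by
  rintro ⟨r, hr⟩
  apply hx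
  rw [← squeeze_unsqueeze hxpq, ← hr]
  exact squeeze_ratCast p q r

theorem nonempty_homeomorph_irrational_Ioo {p q : ℚ} (hpq : (p : ℝ) < q) :
    Nonempty (((Subtype.val : {x : ℝ // Irrational x} → ℝ) ⁻¹' Ioo (p : ℝ) q) ≃ₜ
      {x : ℝ // Irrational x}) := by
  refine ⟨⟨⟨fun y ↦ ⟨unsqueeze p q y.1.1, y.1.2.unsqueeze y.2⟩,
    fun y ↦ ⟨⟨squeeze p q y.1, y.2.squeeze hpq⟩, squeeze_mem_Ioo hpq y.1⟩, fun y ↦ ?_, fun y ↦ ?_⟩,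
    ?_, ?_⟩⟩
  · exact Subtype.ext (Subtype.ext (squeeze_unsqueeze y.2))
  · exact Subtype.ext (unsqueeze_squeeze hpq y.1)
  · refine Continuous.subtype_mk ?_ _
    exact continuousOn_unsqueeze.comp_continuous
      (continuous_subtype_val.comp continuous_subtype_val) fun y ↦ y.2
  · exact ((continuous_squeeze.comp continuous_subtype_val).subtype_mk _).subtype_mk _

theorem locallySelfSimilar_irrational : LocallySelfSimilar {x : ℝ // Irrational x} :=
  locallySelfSimilar_of_isInducing_real (E := range ((↑) : ℚ → ℝ)) IsInducing.subtypeVal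
    Rat.isDenseEmbedding_coe_real.dense (fun y ↦ y.2) (by
      rintro _ ⟨p, rfl⟩ _ ⟨q, rfl⟩ hpq
      exact nonempty_homeomorph_irrational_Ioo hpq)

theorem nonempty_natProd_irrational :
    Nonempty (ℕ × {x : ℝ // Irrational x} ≃ₜ {x : ℝ // Irrational x}) :=
  nonempty_natProd_of_real (E := range ((↑) : ℚ → ℝ)) (α := 0) continuous_subtype_val
    (fun y ↦ y.2) (by
      rintro _ ⟨p, rfl⟩ _ ⟨q, rfl⟩ hpq
      exact nonempty_homeomorph_irrational_Ioo hpq)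
    fun n ↦ ⟨n, by simp⟩

end Irrational

/-! ### The five spaces -/

theorem locallySelfSimilar_cantorSet : LocallySelfSimilar cantorSet :=
  locallySelfSimilar_cantorSpace.of_homeomorph cantorSetHomeomorphNatToBool.symm

theorem nowhereDenseHomogeneous_cantorSet : NowhereDenseHomogeneous cantorSet := by
  let φ := cantorSetHomeomorphNatToBool
  have : Nontrivial cantorSet := φ.toEquiv.nontrivial
  refine locallySelfSimilar_cantorSet.nowhereDenseHomogeneous fun U hU hne ↦ ?_
  obtain ⟨k⟩ := nonempty_homeomorph_cantorSpace_of_isClopen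
    (U := φ '' U) ⟨φ.isClosedMap _ hU.isClosed, φ.isOpenMap _ hU.isOpen⟩ (hne.image φ)
  exact ⟨(φ.image U).trans (k.trans φ.symm)⟩

theorem corollary4p9 :
    NowhereDenseHomogeneous cantorSet ∧
    NowhereDenseHomogeneous ℚ ∧
    NowhereDenseHomogeneous {x : ℝ // Irrational x} ∧
    NowhereDenseHomogeneous (cantorSet × ℚ) ∧
    NowhereDenseHomogeneous ({x : ℝ // Irrational x} × ℚ) := by
  have : Nonempty {x : ℝ // Irrational x} := ⟨⟨_, irrational_sqrt_two⟩⟩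
  have : Nonempty cantorSet := ⟨⟨0, zero_mem_cantorSet⟩⟩
  exact ⟨nowhereDenseHomogeneous_cantorSet,
    locallySelfSimilar_rat.nowhereDenseHomogeneous_of_natProd nonempty_natProd_rat,
    locallySelfSimilar_irrational.nowhereDenseHomogeneous_of_natProd nonempty_natProd_irrational,
    (locallySelfSimilar_cantorSet.prod locallySelfSimilar_rat).nowhereDenseHomogeneous_of_natProd
      (nonempty_natProd_prod nonempty_natProd_rat),
    (locallySelfSimilar_irrational.prod locallySelfSimilar_rat).nowhereDenseHomogeneous_of_natProd
      (nonempty_natProd_prod nonempty_natProd_rat)⟩
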